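/- Let $\hat A$ be the $\mathbb C$-algebra of formal series $\sum_{\nu\ge 0}P_\nu(a)\,b^\nu$, $P_\nu\in\mathbb C[[a]]$, with $ab-ba=b^2$ and with left and right multiplication by elements of $\mathbb C[[a]]$ continuous for the $b$-adic filtration. A *simple pole module* is a left $\hat A$-module $F$, free and finitely generated over $\mathbb C[[b]]$, with $aF\subset bF$. A left $\hat A$-module $E$ is *regular* if it embeds in a simple pole module; $E^\sharp$ then denotes the smallest simple pole module containing $E$, and the *Bernstein polynomial* of $E$ is the minimal polynomial of $-b^{-1}a$ on $E^\sharp/bE^\sharp$. $E$ is *geometric* if it is regular and all roots of its Bernstein polynomial are negative rational numbers. A *fresco of rank $k$* is a geometric left $\hat A$-module which is free of rank $k$ over $\mathbb C[[b]]$ and is generated over $\hat A$ by one element. A *change of variable* is a series $\theta\in\mathbb C[[a]]$ with $\theta(0)=0$, $\theta'(0)\neq0$; it is *unimodular*, $\theta(a)=a+\sum_{i\ge2}\theta_ia^i$, if $\theta'(0)=1$. Put $\alpha_\theta=\theta(a)$, $\beta_\theta=b\,\theta'(a)$ and $\Theta\big(\sum P_\nu(a)b^\nu\big)=\sum P_\nu(\alpha_\theta)\beta_\theta^\nu$,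 an automorphism of $\hat A$; $\theta_*(E)$ is the vector space $E$ on which $u\in\hat A$ acts as $\Theta(u)$ acts on $E$. **Theorem.** Let $k\ge 0$ and $\lambda_1,\dots,\lambda_k\in\mathbb C$ (for instance the fundamental invariants of a rank $k$ fresco). Consider independent variables $\theta=(\theta_i)_{i\ge2}$ and $s=(s_{j,i})_{1\le j\le k,\ i\ge1}$. There exist $S_1(\theta,s),\dots,S_k(\theta,s)\in\mathbb C[\theta,s][[b]]$, depending only on $\lambda_1,\dots,\lambda_k$, such that: 1. for every $j$ the constant term in $b$ of $S_j(\theta,s)$ is $1$; 2. for all $S^0_1,\dots,S^0_k\in\mathbb C[[b]]$ with $S^0_j(0)=1$, with coefficients $s^0$ (that is, $S^0_j=1+\sum_{i\ge1}s^0_{j,i}b^i$), one has $S_j(\mathrm{id},s^0)=S^0_j$ for every $j$; 3. for each integer $q\ge0$ there is an integer $m(q)$, depending only on $q$ and $\lambda_1,\dots,\lambda_k$, such that for every $j$ the coefficient of $b^q$ in $S_j(\theta,s)$ involves none of the variables $\theta_i$ and $s_{h,i}$ with $i\ge m(q)$; 4. let $E$ be a rank $k$ fresco and $e$ a generator of $E$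 whose annihilator in $\hat A$ is the left ideal generated by $$P^0=(a-\lambda_1b)(S^0_1)^{-1}(a-\lambda_2b)(S^0_2)^{-1}\cdots(a-\lambda_kb)(S^0_k)^{-1},$$ where $S^0_j\in\mathbb C[[b]]$, $S^0_j(0)=1$, with coefficients $s^0$. Then for every unimodular change of variable $\theta$ the element $e$ generates $\theta_*(E)$, and its annihilator in $\theta_*(E)$ is the left ideal of $\hat A$ generated by $$P(\theta,s^0)=(a-\lambda_1b)S_1(\theta,s^0)[b]^{-1}(a-\lambda_2b)S_2(\theta,s^0)[b]^{-1}\cdots(a-\lambda_kb)S_k(\theta,s^0)[b]^{-1};$$ on $E$ this element acts as $(\alpha_\theta-\lambda_1\beta_\theta)S_1(\theta,s^0)[\beta_\theta]^{-1}\cdots(\alpha_\theta-\lambda_k\beta_\theta)S_k(\theta,s^0)[\beta_\theta]^{-1}$. -/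

import Mathlib

open scoped PowerSeries

universe u

noncomputable section

/-- The algebra `Â` of formal series `∑ P_ν(a) b^ν`, `P_ν ∈ R⟦a⟧`, with `a b - b a = b²`;
for `R = ℂ` this is the usual one. An element is stored as its sequence `ν ↦ P_ν`
(coefficients on the left, powers of `b` on the right). -/
def AHat (R : Type*) [CommRing R] : Type _ := ℕ → R⟦X⟧

namespace AHat

variable {R : Type*} [CommRing R]

instance : AddCommGroup (AHat R) := inferInstanceAs (AddCommGroup (ℕ → R⟦X⟧))
instance : Module R (AHat R) := inferInstanceAs (Module R (ℕ → R⟦X⟧))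

/-- The coefficient `P_n(a)` of `b^n` in `∑ P_ν(a) b^ν`. -/
def coeff (n : ℕ) (x : AHat R) : R⟦X⟧ := x n

/-- The element `∑ f_ν(a) b^ν`. -/
def ofCoeff (f : ℕ → R⟦X⟧) : AHat R := f

@[simp] theorem coeff_ofCoeff (n : ℕ) (f : ℕ → R⟦X⟧) : coeff n (ofCoeff f) = f n := rfl

@[ext] theorem ext {x y : AHat R} (h : ∀ n, coeff n x = coeff n y) : x = y := funext h

@[simp] theorem coeff_add (n : ℕ) (x y : AHat R) : coeff n (x + y) = coeff n x + coeff n y := rfl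
@[simp] theorem coeff_neg (n : ℕ) (x : AHat R) : coeff n (-x) = -coeff n x := rfl
@[simp] theorem coeff_sub (n : ℕ) (x y : AHat R) : coeff n (x - y) = coeff n x - coeff n y := rfl
@[simp] theorem coeff_zero (n : ℕ) : coeff n (0 : AHat R) = 0 := rfl
@[simp] theorem coeff_smul (n : ℕ) (r : R) (x : AHat R) : coeff n (r • x) = r • coeff n x := rfl

theorem coeff_sum {ι : Type*} (n : ℕ) (s : Finset ι) (f : ι → AHat R) :
    coeff n (∑ i ∈ s, f i) = ∑ i ∈ s, coeff n (f i) :=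
  map_sum (⟨⟨coeff n, rfl⟩, fun _ _ => rfl⟩ : AHat R →+ R⟦X⟧) f s

/-- Coefficients of the product `b y`: since `T(a) b = b T(a) + b T'(a) b`, the product
`w = b y = ∑ w_ν(a) b^ν` is determined by `w + (∑ w_ν'(a) b^ν) b = y b`,
i.e. `w_0 = 0` and `w_{n+1} = y_n - w_n'`. -/
def bMulCoeff (y : AHat R) : ℕ → R⟦X⟧
  | 0 => 0
  | n + 1 => coeff n y - PowerSeries.derivative R (bMulCoeff y n)

/-- Left multiplication by `b`. -/
def bMul (y : AHat R) : AHat R := bMulCoeff y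

@[simp] theorem coeff_bMul_zero (y : AHat R) : coeff 0 (bMul y) = 0 := rfl
@[simp] theorem coeff_bMul_succ (n : ℕ) (y : AHat R) :
    coeff (n + 1) (bMul y) = coeff n y - PowerSeries.derivative R (coeff n (bMul y)) := rfl

instance : One (AHat R) := ⟨fun n => if n = 0 then 1 else 0⟩

/-- `(∑ P_ν(a) b^ν) y = ∑ P_ν(a) (b^ν y)`; since `b^ν y ∈ Â b^ν`, only the terms `ν ≤ n` contribute
to the coefficient of `b^n`. -/
instance : Mul (AHat R) :=
  ⟨fun x y n => ∑ ν ∈ Finset.range (n + 1), coeff ν x * coeff n (bMul^[ν] y)⟩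

theorem coeff_one (n : ℕ) : coeff n (1 : AHat R) = if n = 0 then 1 else 0 := rfl

theorem coeff_mul (n : ℕ) (x y : AHat R) :
    coeff n (x * y) = ∑ ν ∈ Finset.range (n + 1), coeff ν x * coeff n (bMul^[ν] y) := rfl

/-- Right multiplication by `b`. -/
def shift (y : AHat R) : AHat R := fun n => match n with
  | 0 => 0
  | n + 1 => coeff n y

/-- Coefficientwise derivation with respect to `a`. -/
def der (y : AHat R) : AHat R := fun n => PowerSeries.derivative R (coeff n y)

@[simp] theorem coeff_shift_zero (y : AHat R) : coeff 0 (shift y) = 0 := rfl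
@[simp] theorem coeff_shift_succ (n : ℕ) (y : AHat R) : coeff (n + 1) (shift y) = coeff n y := rfl
@[simp] theorem coeff_der (n : ℕ) (y : AHat R) :
    coeff n (der y) = PowerSeries.derivative R (coeff n y) := rfl

theorem bMul_add (x y : AHat R) : bMul (x + y) = bMul x + bMul y := by
  ext1 n
  induction n with
  | zero => simp
  | succ n ih => simp only [coeff_bMul_succ, coeff_add, ih, map_add]; abel

theorem bMul_smul (r : R) (x : AHat R) : bMul (r • x) = r • bMul x := by
  ext1 n
  induction n with
  | zero => simp
  | succ n ih => simp only [coeff_bMul_succ, coeff_smul, ih, smul_sub, Derivation.map_smul]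

theorem bMul_zero : bMul (0 : AHat R) = 0 := by
  simpa using bMul_smul (0 : R) (0 : AHat R)

theorem bMul_shift (x : AHat R) : bMul (shift x) = shift (bMul x) := by
  ext1 n
  induction n with
  | zero => simp
  | succ n ih =>
    rw [coeff_bMul_succ, ih, coeff_shift_succ]
    cases n <;> simp

theorem bMul_der (x : AHat R) : bMul (der x) = der (bMul x) := by
  ext1 n
  induction n with
  | zero => simp
  | succ n ih => simp [ih]

theorem bMul_eq (x : AHat R) : bMul x + shift (der (bMul x)) = shift x := by
  ext1 n
  cases n <;> simp

theorem iter_add (k : ℕ) (x y : AHat R) : bMul^[k] (x + y) = bMul^[k] x + bMul^[k] y := by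
  induction k with
  | zero => rfl
  | succ k ih => simp only [Function.iterate_succ_apply', ih, bMul_add]

theorem iter_smul (k : ℕ) (r : R) (x : AHat R) : bMul^[k] (r • x) = r • bMul^[k] x := by
  induction k with
  | zero => rfl
  | succ k ih => simp only [Function.iterate_succ_apply', ih, bMul_smul]

theorem iter_shift (k : ℕ) (x : AHat R) : bMul^[k] (shift x) = shift (bMul^[k] x) := by
  induction k with
  | zero => rfl
  | succ k ih => simp only [Function.iterate_succ_apply', ih, bMul_shift]

theorem iter_der (k : ℕ) (x : AHat R) : bMul^[k] (der x) = der (bMul^[k] x) := by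
  induction k with
  | zero => rfl
  | succ k ih => simp only [Function.iterate_succ_apply', ih, bMul_der]

/-- `bMul` raises the order in `b`. -/
theorem coeff_iter_of_lt {k n : ℕ} (h : n < k) (x : AHat R) : coeff n (bMul^[k] x) = 0 := by
  induction k generalizing n with
  | zero => omega
  | succ k ih =>
    rw [Function.iterate_succ_apply']
    induction n with
    | zero => simp
    | succ n ihn => rw [coeff_bMul_succ, ihn (by omega), ih (by omega)]; simp

theorem coeff_mul_of_le {n N : ℕ} (h : n < N) (x y : AHat R) :
    coeff n (x * y) = ∑ ν ∈ Finset.range N, coeff ν x * coeff n (bMul^[ν] y) := by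
  rw [coeff_mul]
  refine Finset.sum_subset (fun i hi => ?_) (fun i _ hi => ?_)
  · simp only [Finset.mem_range] at *; omega
  · rw [coeff_iter_of_lt (by simpa using hi), mul_zero]

theorem add_mul' (x y z : AHat R) : (x + y) * z = x * z + y * z := by
  ext1 n
  simp [coeff_mul, add_mul, Finset.sum_add_distrib]

theorem mul_add' (x y z : AHat R) : x * (y + z) = x * y + x * z := by
  ext1 n
  simp [coeff_mul, iter_add, mul_add, Finset.sum_add_distrib]

theorem mul_shift (x y : AHat R) : x * shift y = shift (x * y) := by
  ext1 n
  cases n with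
  | zero => simp [coeff_mul]
  | succ n =>
    rw [coeff_mul, coeff_shift_succ, coeff_mul_of_le (N := n + 2) (by omega)]
    simp [iter_shift]

theorem shift_mul (x y : AHat R) : shift x * y = x * bMul y := by
  ext1 n
  rw [coeff_mul_of_le (N := n + 2) (by omega), coeff_mul, Finset.sum_range_succ']
  simp [Function.iterate_succ_apply]

theorem der_mul (x y : AHat R) : der (x * y) = der x * y + x * der y := by
  ext1 n
  simp only [coeff_der, coeff_mul, coeff_add, map_sum, Derivation.leibniz, smul_eq_mul, iter_der,
    ← Finset.sum_add_distrib]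
  refine Finset.sum_congr rfl fun i _ => by ring

/-- The equation characterizing `bMul`. -/
theorem eq_bMul_of {w y : AHat R} (h : w + shift (der w) = shift y) : w = bMul y := by
  have h' : ∀ n, coeff n (w + shift (der w)) = coeff n (shift y) := fun n => by rw [h]
  ext1 n
  induction n with
  | zero => simpa using h' 0
  | succ n ih => 
    have := h' (n + 1)
    simp only [coeff_add, coeff_shift_succ, coeff_der, ih] at this
    rw [coeff_bMul_succ, ← this]; abel

theorem bMul_mul (y z : AHat R) : bMul y * z = bMul (y * z) := by
  apply eq_bMul_of
  have e1 : ∀ v : AHat R, bMul y * v + der (bMul y) * bMul v = y * bMul v := fun v => by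
    rw [← shift_mul, ← shift_mul, ← add_mul', bMul_eq]
  have e2 := e1 z
  have e3 := e1 (shift (der z))
  rw [bMul_shift, bMul_der] at e3
  have e4 := bMul_eq z
  rw [der_mul, ← mul_shift]
  have e5 : ∀ u v : AHat R, shift (u + v) = shift u + shift v := fun u v => by
    ext1 n; cases n <;> simp
  rw [e5, ← mul_shift, ← mul_shift, ← e4, mul_add', mul_add', ← e2, ← e3]
  abel

theorem iter_mul (k : ℕ) (y z : AHat R) : bMul^[k] y * z = bMul^[k] (y * z) := by
  induction k with
  | zero => rfl
  | succ k ih => simp only [Function.iterate_succ_apply', bMul_mul, ih]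

theorem mul_assoc' (x y z : AHat R) : x * y * z = x * (y * z) := by
  ext1 n
  rw [coeff_mul, coeff_mul]
  have h1 : ∀ ν ∈ Finset.range (n + 1), coeff ν (x * y) * coeff n (bMul^[ν] z)
      = ∑ μ ∈ Finset.range (n + 1), coeff μ x * (coeff ν (bMul^[μ] y) * coeff n (bMul^[ν] z)) := by
    intro ν hν
    rw [coeff_mul_of_le (N := n + 1) (by simpa using hν), Finset.sum_mul]
    exact Finset.sum_congr rfl fun _ _ => by ring
  rw [Finset.sum_congr rfl h1, Finset.sum_comm]
  refine Finset.sum_congr rfl fun μ _ => ?_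
  rw [← Finset.mul_sum, ← iter_mul, coeff_mul]

theorem iter_one (k n : ℕ) : coeff n (bMul^[k] (1 : AHat R)) = if n = k then 1 else 0 := by
  induction k generalizing n with
  | zero => rfl
  | succ k ih =>
    rw [Function.iterate_succ_apply']
    induction n with
    | zero => simp
    | succ n ihn =>
      rw [coeff_bMul_succ, ihn, ih]
      split_ifs <;> simp_all

theorem one_mul' (x : AHat R) : 1 * x = x := by
  ext1 n
  rw [coeff_mul, Finset.sum_eq_single 0] <;> simp +contextual [coeff_one]

theorem mul_one' (x : AHat R) : x * 1 = x := by
  ext1 n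
  rw [coeff_mul, Finset.sum_eq_single n] <;> simp +contextual [iter_one]
  intros; omega

instance : Ring (AHat R) where
  __ := (inferInstance : AddCommGroup (AHat R))
  mul_assoc := mul_assoc'
  one_mul := one_mul'
  mul_one := mul_one'
  left_distrib := mul_add'
  right_distrib := add_mul'
  zero_mul x := by ext1 n; simp [coeff_mul]
  mul_zero x := by
    have := mul_add' x 0 0
    simpa using this

instance : Algebra R (AHat R) := Algebra.ofModule
  (fun r x y => by ext1 n; simp [coeff_mul, Finset.smul_sum])
  (fun r x y => by ext1 n; simp [coeff_mul, iter_smul, Finset.smul_sum])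

/-- The inclusion `R⟦a⟧ ⊂ Â`, `P ↦ P(a)`. -/
def ofA : R⟦X⟧ →+* AHat R where
  toFun P := ofCoeff fun n => if n = 0 then P else 0
  map_zero' := by ext1 n; simp
  map_one' := rfl
  map_add' P Q := by ext1 n; simp only [coeff_ofCoeff, coeff_add]; split_ifs <;> simp
  map_mul' P Q := by
    ext1 n
    rw [coeff_mul, Finset.sum_eq_single 0] <;> simp +contextual

theorem shift_eq_bMul {y : AHat R} (h : der y = 0) : shift y = bMul y := by
  apply eq_bMul_of
  have : der (shift y) = 0 := by
    ext1 n
    cases n with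
    | zero => simp
    | succ n => simpa using congrArg (coeff n) h
  rw [this]
  ext1 n; cases n <;> simp

theorem coeff_iter_of_der {y : AHat R} (h : der y = 0) (k n : ℕ) :
    coeff n (bMul^[k] y) = if k ≤ n then coeff (n - k) y else 0 := by
  induction k generalizing n with
  | zero => simp
  | succ k ih =>
    have h' : der (bMul^[k] y) = 0 := by
      rw [← iter_der, h]; simpa using iter_smul k (0 : R) (0 : AHat R)
    rw [Function.iterate_succ_apply', ← shift_eq_bMul h']
    cases n with
    | zero => simp
    | succ n => simp [ih]

/-- The inclusion `R⟦b⟧ ⊂ Â`, `S ↦ S(b)`. -/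
def ofB : R⟦X⟧ →+* AHat R where
  toFun S := ofCoeff fun n => PowerSeries.C (PowerSeries.coeff n S)
  map_zero' := by ext1 n; simp
  map_one' := by ext1 n; simp only [coeff_ofCoeff, PowerSeries.coeff_one, coeff_one]; split_ifs <;> simp
  map_add' P Q := by ext1 n; simp
  map_mul' P Q := by
    ext1 n
    have h : der (ofCoeff fun n => PowerSeries.C (PowerSeries.coeff n Q)) = 0 := by
      ext1 n; simp
    rw [coeff_ofCoeff, PowerSeries.coeff_mul, Finset.Nat.sum_antidiagonal_eq_sum_range_succ_mk, coeff_mul,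
      map_sum]
    refine Finset.sum_congr rfl fun i hi => ?_
    rw [coeff_iter_of_der h, if_pos (by simpa [Nat.lt_succ_iff] using hi)]
    simp

def a : AHat R := ofA PowerSeries.X

def b : AHat R := ofB PowerSeries.X

theorem coeff_ofA (n : ℕ) (P : R⟦X⟧) : coeff n (ofA P) = if n = 0 then P else 0 := rfl
theorem coeff_ofB (n : ℕ) (S : R⟦X⟧) :
    coeff n (ofB S) = PowerSeries.C (PowerSeries.coeff n S) := rfl

theorem ofA_mul_coeff (n : ℕ) (P : R⟦X⟧) (x : AHat R) : coeff n (ofA P * x) = P * coeff n x := by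
  rw [coeff_mul, Finset.sum_eq_single 0] <;> simp +contextual [coeff_ofA]

theorem b_eq : (b : AHat R) = shift 1 := by
  ext1 n
  rw [b, coeff_ofB, PowerSeries.coeff_X]
  rcases n with _ | _ | n <;> simp [coeff_one]

theorem mul_b (x : AHat R) : x * b = shift x := by
  rw [b_eq, mul_shift, mul_one]

theorem b_mul (x : AHat R) : b * x = bMul x := by
  rw [b_eq, shift_mul, one_mul]

theorem ofA_mul_b (P : R⟦X⟧) :
    ofA P * b = b * ofA P + b * ofA (PowerSeries.derivative R P) * b := by
  have : ofA (PowerSeries.derivative R P) = der (ofA P) := by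
    ext1 n; simp only [coeff_ofA, coeff_der]; split_ifs <;> simp
  rw [this, mul_b, mul_b, b_mul, b_mul, bMul_der, bMul_eq]

theorem a_mul_b : (a * b - b * a : AHat R) = b ^ 2 := by
  rw [a, ofA_mul_b]; simp [pow_two]

theorem coeff_mul_b_pow (n k : ℕ) (x : AHat R) :
    coeff n (x * b ^ k) = if k ≤ n then coeff (n - k) x else 0 := by
  induction k generalizing n with
  | zero => simp
  | succ k ih =>
    rw [pow_succ, ← mul_assoc, mul_b]
    cases n with
    | zero => simp
    | succ n => simp [ih]

/-- Every element is the `b`-adic limit of the partial sums of `∑ P_ν(a) b^ν`. -/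
theorem coeff_sum_range (x : AHat R) {n N : ℕ} (h : n < N) :
    coeff n x = coeff n (∑ ν ∈ Finset.range N, ofA (coeff ν x) * b ^ ν) := by
  rw [coeff_sum, Finset.sum_eq_single n]
  · simp [coeff_mul_b_pow, coeff_ofA]
  · intro i _ hi
    rw [coeff_mul_b_pow, coeff_ofA]
    split_ifs <;> first | rfl | omega
  · simp; omega


theorem coeff_mul_eq_zero_left {x : AHat R} {N : ℕ} (hx : ∀ n < N, coeff n x = 0) (y : AHat R) :
    ∀ n < N, coeff n (x * y) = 0 := fun n hn => by
  rw [coeff_mul]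
  refine Finset.sum_eq_zero fun i hi => ?_
  rw [hx i (by simp at hi; omega), zero_mul]

theorem coeff_mul_eq_zero_right (x : AHat R) {y : AHat R} {N : ℕ} (hy : ∀ n < N, coeff n y = 0) :
    ∀ n < N, coeff n (x * y) = 0 := by
  have key : ∀ k, ∀ n < N, coeff n (bMul^[k] y) = 0 := by
    intro k
    induction k with
    | zero => exact hy
    | succ k ih =>
      rw [Function.iterate_succ_apply']
      intro n
      induction n with
      | zero => simp
      | succ n ihn =>
        intro hn
        rw [coeff_bMul_succ, ih n (by omega), ihn (by omega)]; simp
  intro n hn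
  rw [coeff_mul]
  exact Finset.sum_eq_zero fun i _ => by rw [key i n hn, mul_zero]

end AHat

/-- A change of variable: `θ ∈ R⟦a⟧` with `θ(0) = 0` and `θ'(0)` invertible. -/
structure ChangeOfVariable (R : Type*) [CommRing R] where
  series : R⟦X⟧
  constantCoeff_eq_zero : PowerSeries.constantCoeff series = 0
  isUnit_coeff_one : IsUnit (PowerSeries.coeff 1 series)

namespace ChangeOfVariable
open AHat
variable {R : Type*} [CommRing R] (θ : ChangeOfVariable R)

theorem hasSubst : PowerSeries.HasSubst θ.series :=
  PowerSeries.HasSubst.of_constantCoeff_zero' θ.constantCoeff_eq_zero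

/-- `α = θ(a)`. -/
def alpha : AHat R := ofA θ.series

/-- `β = b θ'(a)`. -/
def beta : AHat R := b * ofA (PowerSeries.derivative R θ.series)

/-- `P ↦ P(α) = (P ∘ θ)(a)`. -/
def phi : R⟦X⟧ →+* AHat R := ofA.comp (PowerSeries.substAlgHom θ.hasSubst).toRingHom

theorem phi_apply (P : R⟦X⟧) : θ.phi P = ofA (P.subst θ.series) := by
  simp [phi, PowerSeries.coe_substAlgHom]

/-- `∑ P_ν(a) b^ν ↦ ∑ P_ν(α) β^ν`; since `β^ν ∈ Â b^ν`, only the terms `ν ≤ n` contribute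
to the coefficient of `b^n`. -/
def toFun (x : AHat R) : AHat R :=
  ofCoeff fun n => coeff n (∑ ν ∈ Finset.range (n + 1), θ.phi (coeff ν x) * θ.beta ^ ν)

theorem phi_mul_beta (P : R⟦X⟧) :
    θ.phi P * θ.beta = θ.beta * θ.phi P + θ.beta * θ.phi (PowerSeries.derivative R P) * θ.beta := by
  rw [phi_apply, phi_apply, beta, ← mul_assoc, ofA_mul_b, PowerSeries.derivative_subst θ.hasSubst,
    map_mul]
  have c : ∀ P Q : R⟦X⟧, ofA P * ofA Q = ofA Q * ofA P := fun P Q => by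
    rw [← map_mul, mul_comm, map_mul]
  rw [add_mul]
  congr 1
  · rw [mul_assoc, c, mul_assoc]
  · rw [c]; simp only [mul_assoc]

theorem coeff_mul_beta_pow (x : AHat R) (k : ℕ) : ∀ n < k, coeff n (x * θ.beta ^ k) = 0 := by
  induction k generalizing x with
  | zero => simp
  | succ k ih =>
    intro n hn
    rw [pow_succ']
    have : x * (θ.beta * θ.beta ^ k)
      = x * (b * (ofA (PowerSeries.derivative R θ.series) * beta θ ^ k)) := by
      rw [← mul_assoc b]; rfl
    rw [this]
    refine coeff_mul_eq_zero_right (N := k + 1) x ?_ n hn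
    intro m
    rw [b_mul]
    induction m with
    | zero => simp
    | succ m ihm =>
      intro hm
      rw [coeff_bMul_succ, ihm (by omega), ih _ _ (by omega)]; simp

theorem coeff_toFun {n N : ℕ} (h : n < N) (x : AHat R) :
    coeff n (θ.toFun x) =
      coeff n (∑ ν ∈ Finset.range N, θ.phi (coeff ν x) * θ.beta ^ ν) := by
  rw [toFun, coeff_ofCoeff, coeff_sum, coeff_sum]
  refine Finset.sum_subset (fun i hi => ?_) (fun i _ hi => ?_)
  · simp only [Finset.mem_range] at *; omega
  · exact θ.coeff_mul_beta_pow _ _ _ (by simpa using hi)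

/-- Truncation of the image. -/
def part (N : ℕ) (x : AHat R) : AHat R := ∑ ν ∈ Finset.range N, θ.phi (coeff ν x) * θ.beta ^ ν

theorem toFun_sub_part (N : ℕ) (x : AHat R) :
    ∀ n < N, coeff n (θ.toFun x - θ.part N x) = 0 := fun n hn => by
  rw [coeff_sub, θ.coeff_toFun hn, part, sub_self]

theorem toFun_add (x y : AHat R) : θ.toFun (x + y) = θ.toFun x + θ.toFun y := by
  ext1 n
  simp [toFun, add_mul, Finset.sum_add_distrib]

theorem toFun_neg (x : AHat R) : θ.toFun (-x) = -θ.toFun x := by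
  ext1 n
  simp [toFun]

theorem toFun_shift (x : AHat R) : θ.toFun (shift x) = θ.toFun x * θ.beta := by
  ext1 n
  have h := coeff_mul_eq_zero_left (θ.toFun_sub_part (n + 1) x) θ.beta n (by omega)
  rw [sub_mul, coeff_sub, sub_eq_zero] at h
  rw [h, θ.coeff_toFun (N := n + 2) (by omega), Finset.sum_range_succ', part, Finset.sum_mul]
  simp [pow_succ, mul_assoc]

theorem toFun_mul_beta (x : AHat R) :
    θ.toFun x * θ.beta = θ.beta * θ.toFun x + θ.beta * θ.toFun (der x) * θ.beta := by
  ext1 n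
  have h1 := coeff_mul_eq_zero_left (θ.toFun_sub_part (n + 1) x) θ.beta n (by omega)
  have h2 := coeff_mul_eq_zero_right θ.beta (θ.toFun_sub_part (n + 1) x) n (by omega)
  have h3 := coeff_mul_eq_zero_left (coeff_mul_eq_zero_right θ.beta
    (θ.toFun_sub_part (n + 1) (der x))) θ.beta n (by omega)
  rw [sub_mul, coeff_sub, sub_eq_zero] at h1
  rw [mul_sub, coeff_sub, sub_eq_zero] at h2
  rw [mul_sub, sub_mul, coeff_sub, sub_eq_zero] at h3
  rw [coeff_add, h1, h2, h3, ← coeff_add]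
  congr 1
  simp only [part, Finset.sum_mul, Finset.mul_sum, ← Finset.sum_add_distrib]
  refine Finset.sum_congr rfl fun i _ => ?_
  rw [mul_assoc, ← pow_succ, pow_succ', ← mul_assoc, phi_mul_beta, add_mul, coeff_der]
  simp only [mul_assoc, ← pow_succ, ← pow_succ']

theorem toFun_bMul (x : AHat R) : θ.toFun (bMul x) = θ.beta * θ.toFun x := by
  have step : ∀ y : AHat R, θ.toFun (bMul y) - θ.beta * θ.toFun y =
      -(θ.toFun (bMul (der y)) - θ.beta * θ.toFun (der y)) * θ.beta := fun y => by
    have h1 := θ.toFun_mul_beta y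
    rw [← toFun_shift, ← bMul_eq y, toFun_add, toFun_shift, ← bMul_der] at h1
    rw [eq_sub_of_add_eq h1]
    noncomm_ring
  have iter : ∀ k (y : AHat R), ∃ z, θ.toFun (bMul y) - θ.beta * θ.toFun y = z * θ.beta ^ k := by
    intro k
    induction k with
    | zero => exact fun y => ⟨θ.toFun (bMul y) - θ.beta * θ.toFun y, by simp⟩
    | succ k ih =>
      intro y
      obtain ⟨z, hz⟩ := ih (der y)
      exact ⟨-z, by rw [step, hz, pow_succ]; noncomm_ring⟩
  ext1 n
  obtain ⟨z, hz⟩ := iter (n + 1) x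
  have := congrArg (coeff n) hz
  rwa [θ.coeff_mul_beta_pow _ _ _ (by omega), coeff_sub, sub_eq_zero] at this

theorem toFun_iter (k : ℕ) (x : AHat R) : θ.toFun (bMul^[k] x) = θ.beta ^ k * θ.toFun x := by
  induction k with
  | zero => simp
  | succ k ih => rw [Function.iterate_succ_apply', toFun_bMul, ih, pow_succ', mul_assoc]

theorem toFun_ofA_mul (P : R⟦X⟧) (x : AHat R) : θ.toFun (ofA P * x) = θ.phi P * θ.toFun x := by
  ext1 n
  have h2 := coeff_mul_eq_zero_right (θ.phi P) (θ.toFun_sub_part (n + 1) x) n (by omega)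
  rw [mul_sub, coeff_sub, sub_eq_zero] at h2
  rw [h2, part, toFun, coeff_ofCoeff, Finset.mul_sum]
  simp only [ofA_mul_coeff, map_mul, mul_assoc]

theorem toFun_congr {x y : AHat R} {N : ℕ} (h : ∀ n < N, coeff n x = coeff n y) :
    ∀ n < N, coeff n (θ.toFun x) = coeff n (θ.toFun y) := fun n hn => by
  rw [θ.coeff_toFun hn, θ.coeff_toFun hn]
  congr 1
  exact Finset.sum_congr rfl fun i hi => by rw [h i (by simpa using hi)]

theorem toFun_zero : θ.toFun 0 = 0 := by
  ext1 n
  simp [toFun]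

theorem toFun_sum {ι : Type*} (s : Finset ι) (f : ι → AHat R) :
    θ.toFun (∑ i ∈ s, f i) = ∑ i ∈ s, θ.toFun (f i) :=
  map_sum (⟨⟨θ.toFun, θ.toFun_zero⟩, θ.toFun_add⟩ : AHat R →+ AHat R) f s

theorem toFun_mul (x y : AHat R) : θ.toFun (x * y) = θ.toFun x * θ.toFun y := by
  ext1 n
  have h1 := coeff_mul_eq_zero_left (θ.toFun_sub_part (n + 1) x) (θ.toFun y) n (by omega)
  rw [sub_mul, coeff_sub, sub_eq_zero] at h1
  have h2 : ∀ m < n + 1, coeff m (x * y) =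
      coeff m (∑ ν ∈ Finset.range (n + 1), ofA (coeff ν x) * bMul^[ν] y) := fun m hm => by
    rw [coeff_mul_of_le hm, coeff_sum]
    simp only [ofA_mul_coeff]
  rw [h1, θ.toFun_congr h2 n (by omega), toFun_sum, part, Finset.sum_mul]
  simp only [toFun_ofA_mul, toFun_iter, mul_assoc]

theorem toFun_ofA (P : R⟦X⟧) : θ.toFun (ofA P) = θ.phi P := by
  ext1 n
  rw [θ.coeff_toFun (N := n + 1) (by omega), Finset.sum_eq_single 0]
  · simp [coeff_ofA]
  · intro i _ hi; simp [coeff_ofA, hi]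
  · simp

/-- The endomorphism `Θ` of `Â`, `∑ P_ν(a) b^ν ↦ ∑ P_ν(α) β^ν`. -/
def hom : AHat R →+* AHat R where
  toFun := θ.toFun
  map_zero' := θ.toFun_zero
  map_add' := θ.toFun_add
  map_one' := by rw [← map_one ofA, toFun_ofA, map_one, map_one]
  map_mul' := θ.toFun_mul

theorem hom_a : θ.hom a = θ.alpha := by
  show θ.toFun (ofA _) = _
  rw [toFun_ofA, phi_apply, PowerSeries.subst_X θ.hasSubst]; rfl

theorem hom_b : θ.hom b = θ.beta := by
  show θ.toFun _ = _
  rw [b_eq, toFun_shift, ← map_one ofA, toFun_ofA, map_one, one_mul]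

end ChangeOfVariable

/-- `θ_*(E)`: the same additive group as `E`, on which `u ∈ Â` acts as `Θ(u)` acts on `E`. -/
def Pushforward {R : Type*} [CommRing R] (_θ : ChangeOfVariable R) (E : Type*) : Type _ := E

namespace Pushforward

variable {R : Type*} [CommRing R] (θ : ChangeOfVariable R) (E : Type*) [AddCommGroup E]

instance : AddCommGroup (Pushforward θ E) := inferInstanceAs (AddCommGroup E)

instance [Module (AHat R) E] : Module (AHat R) (Pushforward θ E) :=
  Module.compHom E θ.hom

/-- The identity map, viewing an element of `E` as an element of `θ_*(E)`. -/
def of : E ≃+ Pushforward θ E := AddEquiv.refl E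

theorem smul_of [Module (AHat R) E] (u : AHat R) (x : E) : u • of θ E x = of θ E (θ.hom u • x) :=
  rfl

end Pushforward

section Fresco

open AHat

/-- `E` is free of rank `k` over `ℂ⟦b⟧ ⊂ Â`: it has a `ℂ⟦b⟧`-basis with `k` elements. -/
def IsFreeOfRank (k : ℕ) (E : Type*) [AddCommGroup E] [Module (AHat ℂ) E] : Prop :=
  ∃ v : Fin k → E, Function.Bijective fun S : Fin k → ℂ⟦X⟧ => ∑ i, ofB (S i) • v i

/-- Simple pole module: free and finitely generated over `ℂ⟦b⟧`, with `a F ⊂ b F`. -/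
def IsSimplePole (F : Type*) [AddCommGroup F] [Module (AHat ℂ) F] : Prop :=
  (∃ n, IsFreeOfRank n F) ∧ ∀ x : F, ∃ y : F, (a : AHat ℂ) • x = (b : AHat ℂ) • y

/-- `i : E → F` is the saturation `E ⊂ E^♯`: `F` is a simple pole module containing `E` and no proper
submodule `G ⊃ E` of `F` satisfies `a G ⊂ b G`. It exists exactly when `E` is regular, that is, when
`E` embeds in a simple pole module. -/
structure IsSaturation {E F : Type*} [AddCommGroup E] [Module (AHat ℂ) E]
    [AddCommGroup F] [Module (AHat ℂ) F] (i : E →ₗ[AHat ℂ] F) : Prop where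
  injective : Function.Injective i
  isSimplePole : IsSimplePole F
  minimal : ∀ G : Submodule (AHat ℂ) F, LinearMap.range i ≤ G →
    (∀ x ∈ G, ∃ y ∈ G, (a : AHat ℂ) • x = (b : AHat ℂ) • y) → G = ⊤

/-- For a simple pole module `F`, the number `ρ` is an eigenvalue of the action of `-b⁻¹ a` on
`F / b F`: some `x ∉ b F` satisfies `a x + ρ b x ∈ b² F`. For `F = E^♯` these eigenvalues are the
roots of the Bernstein polynomial of `E` (the minimal polynomial of that action). -/
def IsBernsteinRoot (F : Type*) [AddCommGroup F] [Module (AHat ℂ) F] (ρ : ℂ) : Prop :=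
  ∃ x : F, (¬ ∃ y : F, x = (b : AHat ℂ) • y) ∧
    ∃ z : F, (a + ρ • b : AHat ℂ) • x = (b ^ 2 : AHat ℂ) • z

/-- Geometric: regular, and all roots of the Bernstein polynomial are negative rational numbers. -/
def IsGeometric (E : Type u) [AddCommGroup E] [Module (AHat ℂ) E] : Prop :=
  ∃ (F : Type u) (_ : AddCommGroup F) (_ : Module (AHat ℂ) F) (i : E →ₗ[AHat ℂ] F),
    IsSaturation i ∧ ∀ ρ : ℂ, IsBernsteinRoot F ρ → ∃ q : ℚ, q < 0 ∧ ρ = q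

/-- `e` generates `E` as a left `Â`-module. -/
def IsGenerator {E : Type*} [AddCommGroup E] [Module (AHat ℂ) E] (e : E) : Prop :=
  Submodule.span (AHat ℂ) {e} = ⊤

/-- A fresco of rank `k`: a geometric module, free of rank `k` over `ℂ⟦b⟧`, with one generator
over `Â`. -/
structure IsFresco (k : ℕ) (E : Type u) [AddCommGroup E] [Module (AHat ℂ) E] : Prop where
  isFreeOfRank : IsFreeOfRank k E
  isGeometric : IsGeometric E
  monogenic : ∃ e : E, IsGenerator e

/-- The annihilator of `e` is the left ideal `Â P`. -/
def AnnihilatorGeneratedBy {E : Type*} [AddCommGroup E] [Module (AHat ℂ) E] (e : E)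
    (P : AHat ℂ) : Prop :=
  ∀ u : AHat ℂ, u • e = 0 ↔ ∃ v : AHat ℂ, u = v * P

/-- `(a - λ₁ b) S₁(b)⁻¹ (a - λ₂ b) S₂(b)⁻¹ ⋯ (a - λ_k b) S_k(b)⁻¹`. -/
def frescoElement {k : ℕ} (lam : Fin k → ℂ) (S : Fin k → ℂ⟦X⟧) : AHat ℂ :=
  (List.ofFn fun j => (a - lam j • b) * ofB (S j)⁻¹).prod

/-- The variables `θ_i` (`i ≥ 2`) and `s_{j,i}` (`1 ≤ j ≤ k`, `i ≥ 1`). -/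
abbrev CoeffVar (k : ℕ) : Type := {i : ℕ // 2 ≤ i} ⊕ (Fin k × {i : ℕ // 1 ≤ i})

/-- The index `i` of `θ_i`, resp. of `s_{j,i}`. -/
def CoeffVar.index {k : ℕ} : CoeffVar k → ℕ
  | .inl i => i
  | .inr p => p.2

/-- The values of the variables given by `θ = a + ∑ θ_i a^i` and `S_j = 1 + ∑ s_{j,i} b^i`. -/
def CoeffVar.value {k : ℕ} (θ : ℂ⟦X⟧) (S : Fin k → ℂ⟦X⟧) : CoeffVar k → ℂ
  | .inl i => PowerSeries.coeff i θ
  | .inr p => PowerSeries.coeff p.2 (S p.1)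

/-- The value in `ℂ⟦b⟧` of an element of `ℂ[θ, s]⟦b⟧` at given `θ` and `S_1, …, S_k`. -/
def specialize {k : ℕ} (θ : ℂ⟦X⟧) (S : Fin k → ℂ⟦X⟧)
    (T : PowerSeries (MvPolynomial (CoeffVar k) ℂ)) : ℂ⟦X⟧ :=
  PowerSeries.map (MvPolynomial.eval (CoeffVar.value θ S)) T

end Fresco

end

noncomputable section

/-! An element `u` kills `e` in `θ_*(E)` iff `Θ(u)` kills `e` in `E`, that is, iff `Θ(u) ∈ Â P⁰`. As
`Θ` is bijective, the annihilator is `Â Θ⁻¹(P⁰)`, and it remains to write `Θ⁻¹(P⁰)` as a unit times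
a product of the required form, with universal coefficients.

For unimodular `θ`, each factor of `Θ⁻¹(P⁰)` still has initial form `a - λ_j b`. Such an element is
a unit times `a - f(b)` with `f = λ_j b + O(b²)`, by a division in the style of Weierstrass
(`HasInitialForm.exists_eq_mul_sub_ofB`). The commutation rule `a S(b) = S(b) a + b² S'(b)` then
reduces `a - f(b) = S (a - λ_j b) S⁻¹` to a linear differential equation for `S`, solved by an
exponential (`HasInitialForm.exists_eq_mul`). In a product the factors are treated from right to
left: the unit produced on the right is absorbed by the next factor, whose initial form does not
change (`exists_prod_eq`).

All this is done once, over the ring `ℂ[θ, s]`, for the change of variable and the series with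
indeterminate coefficients; this yields the `S_j`. Part 3 holds because a polynomial has finitely
many variables. Part 2 follows from uniqueness of the factorization (`eq_of_mul_eq`), as nothing has
to be changed at `θ = id`. Part 4 follows by specializing the variables, `Â` and `Θ` being
functorial in the coefficients (`map_hom`). -/

theorem exists_eq_of_strong_recursion {α : Type*} [Zero α] (F : ℕ → (ℕ → α) → α) :
    ∃ u : ℕ → α, ∀ n, u n = F n fun m => if m < n then u m else 0 := by
  refine ⟨WellFounded.fix (C := fun _ => α) Nat.lt_wfRel.wf
    fun n v => F n fun m => if h : m < n then v m h else 0, fun n => ?_⟩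
  rw [WellFounded.fix_eq]
  congr 1

/-! ### Power series: a linear differential equation. -/

namespace PowerSeries

variable {R : Type*} [CommRing R]

theorem exists_X_mul_eq {P : R⟦X⟧} (h : constantCoeff P = 0) :
    X * (mk fun n => coeff (n + 1) P) = P := by
  conv_rhs => rw [eq_X_mul_shift_add_const P, h, map_zero, add_zero]

theorem map_derivative {S : Type*} [CommRing S] (f : R →+* S) (P : R⟦X⟧) :
    map f (derivative R P) = derivative S (map f P) := by
  ext n
  simp [coeff_derivative]

/-- The linear differential equation `S' = h S`, `S(0) = 1`. -/
theorem exists_derivative_eq_mul [Algebra ℚ R] (h : R⟦X⟧) :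
    ∃ S : R⟦X⟧, constantCoeff S = 1 ∧ derivative R S = h * S := by
  -- The solution is `exp(H)`, where `H` is the primitive of `h` with `H(0) = 0`; the divisions by
  -- `n + 1` need `ℚ ⊂ R`.
  let H : R⟦X⟧ := X * mk fun n => algebraMap ℚ R (1 / (n + 1)) * coeff n h
  have hH0 : constantCoeff H = 0 := by simp [H]
  have hH : HasSubst H := HasSubst.of_constantCoeff_zero' hH0
  have hd : derivative R H = h := by
    ext n
    have : (algebraMap ℚ R (1 / (n + 1))) * ((n : R) + 1) = 1 := by
      have e : ((n : R) + 1) = algebraMap ℚ R (n + 1) := by simp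
      rw [e, ← map_mul, one_div_mul_cancel (by positivity), map_one]
    rw [coeff_derivative, coeff_succ_X_mul, coeff_mk, mul_right_comm, this, one_mul]
  refine ⟨(exp R).subst H, ?_, ?_⟩
  · have h1 : exp R = 1 + (exp R - 1) := by ring
    rw [h1, subst_add hH, ← map_one C, subst_C, map_add]
    have := constantCoeff_subst_eq_zero hH0 (exp R - 1) (by simp)
    have e : (constantCoeff : R⟦X⟧ →+* R) = MvPowerSeries.constantCoeff := rfl
    rw [map_one C, e, this]; simp
  · rw [derivative_subst hH, derivative_exp, hd, mul_comm]

end PowerSeries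

/-! ### Commutation formulas, division and factorization in `Â`. -/

namespace AHat

variable {R : Type*} [CommRing R]

theorem iter_bMul_eq (k : ℕ) (x : AHat R) : bMul^[k] x = b ^ k * x := by
  induction k with
  | zero => simp
  | succ k ih => rw [Function.iterate_succ_apply', ih, pow_succ', mul_assoc, b_mul]

theorem b_pow_mul_a (k : ℕ) : (b ^ k * a : AHat R) = a * b ^ k - k • b ^ (k + 1) := by
  induction k with
  | zero => simp
  | succ k ih =>
    have h : (b * a : AHat R) = a * b - b ^ 2 := by rw [← a_mul_b]; abel
    rw [pow_succ', mul_assoc, ih, mul_sub, ← mul_assoc, h, mul_smul_comm, sub_mul, mul_assoc,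
      ← pow_succ', ← pow_succ', ← pow_add, add_comm 2 k, succ_nsmul]
    abel

theorem coeff_nsmul (m n : ℕ) (x : AHat R) : coeff n (m • x) = m • coeff n x :=
  map_nsmul (⟨⟨coeff n, rfl⟩, fun _ _ => rfl⟩ : AHat R →+ R⟦X⟧) m x

theorem coeff_a_mul (n : ℕ) (x : AHat R) : coeff n (a * x) = PowerSeries.X * coeff n x :=
  ofA_mul_coeff n _ x

theorem coeff_b_pow (n k : ℕ) : coeff n (b ^ k : AHat R) = if n = k then 1 else 0 := by
  rw [← iter_one, iter_bMul_eq, mul_one]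

theorem coeff_iter_bMul_a (n k : ℕ) : coeff n (bMul^[k] (a : AHat R)) =
    (if n = k then PowerSeries.X else 0) - if n = k + 1 then (k : R⟦X⟧) else 0 := by
  rw [iter_bMul_eq, b_pow_mul_a, coeff_sub, coeff_nsmul, coeff_a_mul, coeff_b_pow, coeff_b_pow]
  split_ifs <;> simp

theorem coeff_mul_a_zero (x : AHat R) : coeff 0 (x * a) = PowerSeries.X * coeff 0 x := by
  rw [coeff_mul]
  simp [mul_comm, a, coeff_ofA]

theorem coeff_mul_a_succ (n : ℕ) (x : AHat R) :
    coeff (n + 1) (x * a) = PowerSeries.X * coeff (n + 1) x - (n : R⟦X⟧) * coeff n x := by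
  rw [coeff_mul, Finset.sum_range_succ, Finset.sum_range_succ, Finset.sum_eq_zero]
  · simp only [coeff_iter_bMul_a]
    simp
    ring
  · intro i hi
    rw [Finset.mem_range] at hi
    rw [coeff_iter_bMul_a, if_neg (by omega), if_neg (by omega)]
    simp

theorem coeff_mul_ofB (n : ℕ) (x : AHat R) (f : R⟦X⟧) : coeff n (x * ofB f) =
    ∑ i ∈ Finset.range (n + 1), coeff (n - i) x * PowerSeries.C (PowerSeries.coeff i f) := by
  have h : der (ofB f) = 0 := by ext1 m; simp [coeff_ofB]
  rw [coeff_mul, ← Finset.sum_range_reflect]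
  refine Finset.sum_congr rfl fun i hi => ?_
  rw [Finset.mem_range] at hi
  rw [coeff_iter_of_der h, if_pos (by omega), coeff_ofB]
  congr 4
  omega

theorem smul_b (r : R) : (r • b : AHat R) = ofB (PowerSeries.C r * PowerSeries.X) := by
  ext1 n
  rw [coeff_smul, coeff_ofB, b, coeff_ofB]
  simp [PowerSeries.smul_eq_C_mul]

/-- The commutator with `a` acts on `R⟦b⟧` as the derivation `b² d/db`, since it sends `b` to `b²`.
Conjugating by a series in `b` thus becomes a differential equation. -/
theorem a_mul_ofB (S : R⟦X⟧) :
    a * ofB S = ofB S * a + ofB (PowerSeries.X ^ 2 * PowerSeries.derivative R S) := by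
  ext1 n
  rw [coeff_a_mul, coeff_add]
  rcases n with _ | _ | n
  · rw [coeff_mul_a_zero, coeff_ofB, coeff_ofB, PowerSeries.coeff_X_pow_mul', if_neg (by omega),
      map_zero, add_zero]
  · rw [coeff_mul_a_succ, coeff_ofB, coeff_ofB, coeff_ofB, PowerSeries.coeff_X_pow_mul',
      if_neg (by omega)]
    simp
  · rw [coeff_mul_a_succ]
    simp only [coeff_ofB, PowerSeries.coeff_X_pow_mul', PowerSeries.coeff_derivative]
    simp
    ring

/-- The initial form of `x` for the filtration by total degree in `a` and `b` is `a - r b`. -/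
structure HasInitialForm (r : R) (x : AHat R) : Prop where
  constantCoeff_zero : PowerSeries.constantCoeff (coeff 0 x) = 0
  coeff_one_zero : PowerSeries.coeff 1 (coeff 0 x) = 1
  constantCoeff_one : PowerSeries.constantCoeff (coeff 1 x) = -r

theorem coeff_zero_mul (x y : AHat R) : coeff 0 (x * y) = coeff 0 x * coeff 0 y := by
  simp [coeff_mul]

/-- Allows a factor of a product to absorb the unit coming from the factors on its right. -/
theorem HasInitialForm.mul {r : R} {x u : AHat R} (hx : HasInitialForm r x)
    (hu : PowerSeries.constantCoeff (coeff 0 u) = 1) : HasInitialForm r (x * u) where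
  constantCoeff_zero := by simp [coeff_zero_mul, hx.constantCoeff_zero]
  coeff_one_zero := by
    rw [coeff_zero_mul, PowerSeries.coeff_mul, Finset.Nat.sum_antidiagonal_eq_sum_range_succ_mk]
    simp [Finset.sum_range_succ, hx.1, hx.2, hu]
  constantCoeff_one := by
    simp [coeff_mul, Finset.sum_range_succ, hx.1, hx.3, hu]

/-- Division: the left ideal generated by `x` contains `a - f(b)` for some `f ∈ R⟦b⟧`. -/
theorem HasInitialForm.exists_eq_mul_sub_ofB {r : R} {x : AHat R} (hx : HasInitialForm r x) :
    ∃ (u : AHat R) (f : R⟦X⟧), PowerSeries.constantCoeff (coeff 0 u) = 1 ∧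
      PowerSeries.coeff 0 f = 0 ∧ PowerSeries.coeff 1 f = r ∧ x = u * (a - ofB f) := by
  let dX : R⟦X⟧ → R⟦X⟧ := fun P => PowerSeries.mk fun n => PowerSeries.coeff (n + 1) P
  -- With `v n = (f_n, u_n)`, comparing the coefficients of `b^n` in `x = u (a - f(b))` gives `a u_n
  -- = G_n + f_n g`, where `g = u_0 = x_0 / a`. Since `g(0) = 1`, the scalar `f_n` is forced: it
  -- makes the right side divisible by `a`.
  let g : R⟦X⟧ := dX (coeff 0 x)
  let G : ℕ → (ℕ → R × R⟦X⟧) → R⟦X⟧ := fun n v => coeff n x + ((n - 1 : ℕ) : R⟦X⟧) * (v (n - 1)).2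
    + ∑ i ∈ Finset.range n, (v (n - i)).2 * PowerSeries.C (v i).1
  let c : ℕ → (ℕ → R × R⟦X⟧) → R := fun n v => -PowerSeries.constantCoeff (G n v)
  obtain ⟨v, hv⟩ := exists_eq_of_strong_recursion
    fun n v => (c n v, dX (G n v + PowerSeries.C (c n v) * g))
  have hg : PowerSeries.constantCoeff g = 1 := by
    rw [← PowerSeries.coeff_zero_eq_constantCoeff_apply]
    simpa [g, dX] using hx.2
  have hv0 : v 0 = (0, g) := by
    rw [hv]; simp [c, G, hx.1, g]
  -- Truncating `v` at `n` is harmless: the term `i = 0` of the sum contains `u_n`, but with the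
  -- factor `f_0 = 0`; and for `n = 0` the index `n - 1 = 0` comes with the coefficient `0`.
  have hG : ∀ n, G n (fun m => if m < n then v m else 0) = G n v := by
    intro n
    simp only [G]
    congr 1
    · rcases n with _ | n <;> simp
    · refine Finset.sum_congr rfl fun i hi => ?_
      rw [Finset.mem_range] at hi
      rcases i with _ | i
      · simp [hv0]
      · rw [if_pos (by omega), if_pos hi]
  have hv1 : ∀ n, (v n).1 = c n v := fun n => by
    rw [hv]; simp only [c, hG]
  have hv2 : ∀ n, PowerSeries.X * (v n).2 = G n v + PowerSeries.C (v n).1 * g := fun n => by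
    rw [hv1]
    conv_lhs => rw [hv]
    simp only [c, hG]
    refine PowerSeries.exists_X_mul_eq ?_
    simp [hg]
  refine ⟨ofCoeff fun n => (v n).2, PowerSeries.mk fun n => (v n).1, ?_, ?_, ?_, ?_⟩
  · rw [coeff_ofCoeff, hv0]; exact hg
  · rw [PowerSeries.coeff_mk, hv0]
  · rw [PowerSeries.coeff_mk, hv1]
    simp [c, G, hv0, hx.3]
  · ext1 n
    rw [mul_sub, coeff_sub, coeff_mul_ofB, Finset.sum_range_succ]
    simp only [coeff_ofCoeff, PowerSeries.coeff_mk, Nat.sub_self, hv0]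
    rcases n with _ | n
    · rw [coeff_mul_a_zero, coeff_ofCoeff, hv2, hv0]
      simp [G]
    · rw [coeff_mul_a_succ, coeff_ofCoeff, coeff_ofCoeff, hv2]
      simp [G]
      ring

/-- Every `x` with initial form `a - r b` is a unit times `(a - r b) S(b)⁻¹`. -/
theorem HasInitialForm.exists_eq_mul [Algebra ℚ R] {r : R} {x : AHat R}
    (hx : HasInitialForm r x) :
    ∃ (u : AHat R) (S T : R⟦X⟧), PowerSeries.constantCoeff (coeff 0 u) = 1 ∧
      PowerSeries.constantCoeff S = 1 ∧ S * T = 1 ∧ x = u * ((a - r • b) * ofB T) := by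
  obtain ⟨u, f, hu, hf0, hf1, rfl⟩ := hx.exists_eq_mul_sub_ofB
  let h : R⟦X⟧ := PowerSeries.mk fun n => PowerSeries.coeff (n + 2) f
  have hf : f = PowerSeries.C r * PowerSeries.X + PowerSeries.X ^ 2 * h := by
    ext n
    rcases n with _ | _ | n
    · simpa using hf0
    · simp [PowerSeries.coeff_X_pow_mul', hf1]
    · simp [PowerSeries.coeff_X_pow_mul', h]
  obtain ⟨S, hS, hS'⟩ := PowerSeries.exists_derivative_eq_mul h
  have hST : S * PowerSeries.invOfUnit S 1 = 1 := PowerSeries.mul_invOfUnit _ _ (by simpa using hS)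
  -- By the commutation rule, `(a - f) S = S a + b² S' - f S`, and `b² S' = b² h S = (f - r b) S`.
  have key : (a - ofB f) * ofB S = ofB S * (a - r • b) := by
    rw [sub_mul, a_mul_ofB, smul_b, mul_sub, add_sub_assoc, sub_eq_add_neg (ofB S * a), ← map_mul,
      ← map_sub, ← map_mul, ← map_neg]
    congr 2
    rw [hS', hf]; ring
  refine ⟨u * ofB S, S, _, ?_, hS, hST, ?_⟩
  · rw [coeff_zero_mul, coeff_ofB]; simp [hu, hS]
  · rw [mul_assoc, ← mul_assoc (ofB S), ← key, mul_assoc, ← map_mul, hST, map_one, mul_one]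

/-- By induction on `n`, once the lower coefficients of `z` vanish, the coefficient of `b^n` on the
left is `a z_n`, while on the right it is a constant; hence `z_n = 0`. -/
theorem eq_zero_of_mul_eq_ofB {r : R} {z : AHat R} {c : R⟦X⟧}
    (h : z * (a - r • b) = ofB c) : z = 0 := by
  have hX : ∀ (P : R⟦X⟧) (s : R), PowerSeries.X * P = PowerSeries.C s → P = 0 := by
    intro P s h
    ext n
    have := congrArg (PowerSeries.coeff (n + 1)) h
    simpa [PowerSeries.coeff_succ_X_mul, PowerSeries.coeff_C] using this
  have h' : ∀ n, coeff n (z * a) - coeff n (r • (z * b)) = coeff n (ofB c) := fun n => by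
    rw [← h, mul_sub, mul_smul_comm, coeff_sub]
  ext1 n
  induction n with
  | zero =>
    refine hX _ (PowerSeries.coeff 0 c) ?_
    have := h' 0
    rwa [coeff_mul_a_zero, coeff_smul, mul_b, coeff_shift_zero, smul_zero, sub_zero] at this
  | succ n ih =>
    refine hX _ (PowerSeries.coeff (n + 1) c) ?_
    have := h' (n + 1)
    rwa [coeff_mul_a_succ, coeff_smul, mul_b, coeff_shift_succ, ih, coeff_zero, smul_zero,
      sub_zero, mul_zero, sub_zero] at this

/-- Uniqueness of the factorization `u (a - r b) T(b)`. -/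
theorem eq_of_mul_eq {K : Type*} [Field K] [CharZero K] {r : K} {u : AHat K} {S T : K⟦X⟧}
    (hS : PowerSeries.constantCoeff S = 1) (hT : PowerSeries.constantCoeff T = 1)
    (h : u * ((a - r • b) * ofB T) = (a - r • b) * ofB S) : u = 1 ∧ T = S := by
  have hT' : T * T⁻¹ = 1 := PowerSeries.mul_inv_cancel _ (by simp [hT])
  have hW : u * (a - r • b) = (a - r • b) * ofB (S * T⁻¹) := by
    rw [map_mul, ← mul_assoc, ← h, mul_assoc, mul_assoc, ← map_mul, hT', map_one, mul_one]
  set W := S * T⁻¹ with hWdef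
  -- Moving `W(b)` across `a - r b` leaves only the commutator `b² W'`, a series in `b`. So `u =
  -- W(b)` and `W' = 0`, whence `W = 1` in characteristic zero.
  have hz : (u - ofB W) * (a - r • b)
      = ofB (PowerSeries.X ^ 2 * PowerSeries.derivative K W) := by
    rw [sub_mul, hW, sub_mul, a_mul_ofB, mul_sub, smul_b, ← map_mul, ← map_mul, mul_comm W]
    abel
  have hu := eq_zero_of_mul_eq_ofB hz
  rw [hu, zero_mul] at hz
  have hder : PowerSeries.derivative K W = 0 := by
    ext n
    have := congrArg PowerSeries.constantCoeff (congrArg (coeff (n + 2)) hz)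
    rw [coeff_ofB, PowerSeries.coeff_X_pow_mul', if_pos (by omega)] at this
    simpa using this.symm
  have hW1 : W = 1 := PowerSeries.derivative.ext (by rw [hder, PowerSeries.derivative_one])
    (by simp [hWdef, hS, hT])
  refine ⟨by rw [sub_eq_zero.mp hu, hW1, map_one], ?_⟩
  rw [← one_mul T, ← hW1, hWdef, mul_assoc, mul_comm _ T, hT', mul_one]

/-- An element with invertible symbol has a left inverse. -/
theorem exists_mul_eq_one {u : AHat R} (hu : PowerSeries.constantCoeff (coeff 0 u) = 1) :
    ∃ v, v * u = 1 := by
  let g : R⟦X⟧ := PowerSeries.invOfUnit (coeff 0 u) 1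
  have hg : g * coeff 0 u = 1 := PowerSeries.invOfUnit_mul _ _ (by simpa using hu)
  -- The coefficient of `b^n` in `b^n u` is `u_0`. Hence `v u = 1` is a triangular system for the
  -- `v_n` with invertible diagonal entry `u_0`.
  have hdiag : ∀ n, coeff n (bMul^[n] u) = coeff 0 u := by
    intro n
    induction n with
    | zero => rfl
    | succ n ih =>
      have h0 : coeff n (bMul^[n + 1] u) = 0 := coeff_iter_of_lt (by omega) u
      rw [Function.iterate_succ_apply'] at h0 ⊢
      rw [coeff_bMul_succ, ih, h0, map_zero, sub_zero]
  obtain ⟨v, hv⟩ := exists_eq_of_strong_recursion fun n (v : ℕ → R⟦X⟧) =>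
    (coeff n 1 - ∑ i ∈ Finset.range n, v i * coeff n (bMul^[i] u)) * g
  refine ⟨ofCoeff v, ?_⟩
  ext1 n
  have hn : v n = (coeff n 1 - ∑ i ∈ Finset.range n, v i * coeff n (bMul^[i] u)) * g := by
    rw [hv]
    congr 2
    refine Finset.sum_congr rfl fun i hi => ?_
    simp only [if_pos (Finset.mem_range.mp hi)]
  rw [coeff_mul, Finset.sum_range_succ]
  simp only [coeff_ofCoeff]
  rw [hdiag, hn, mul_assoc, hg, mul_one]
  abel

/-! ### Functoriality in the coefficients, and factorization of products. -/

section map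

variable {S : Type*} [CommRing S] (f : R →+* S)

theorem coeff_bMul_map (x : AHat R) (n : ℕ) :
    coeff n (bMul (ofCoeff fun m => PowerSeries.map f (coeff m x)))
      = PowerSeries.map f (coeff n (bMul x)) := by
  induction n with
  | zero => simp
  | succ n ih => simp [ih, PowerSeries.map_derivative]

theorem coeff_iter_bMul_map (k : ℕ) (x : AHat R) (n : ℕ) :
    coeff n (bMul^[k] (ofCoeff fun m => PowerSeries.map f (coeff m x)))
      = PowerSeries.map f (coeff n (bMul^[k] x)) := by
  induction k generalizing x with
  | zero => rfl
  | succ k ih =>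
    rw [Function.iterate_succ_apply, Function.iterate_succ_apply, ← ih]
    congr 2
    ext1 m
    rw [coeff_bMul_map, coeff_ofCoeff]

/-- Functoriality of `Â` in the ring of coefficients. -/
def map : AHat R →+* AHat S where
  toFun x := ofCoeff fun n => PowerSeries.map f (coeff n x)
  map_zero' := by ext1 n; simp
  map_one' := by ext1 n; simp only [coeff_ofCoeff, coeff_one]; split_ifs <;> simp
  map_add' x y := by ext1 n; simp
  map_mul' x y := by
    ext1 n
    rw [coeff_ofCoeff, coeff_mul, coeff_mul, map_sum]
    exact Finset.sum_congr rfl fun i _ => by rw [coeff_iter_bMul_map, coeff_ofCoeff, map_mul]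

theorem coeff_map (n : ℕ) (x : AHat R) : coeff n (map f x) = PowerSeries.map f (coeff n x) := rfl

theorem map_ofA (P : R⟦X⟧) : map f (ofA P) = ofA (PowerSeries.map f P) := by
  ext1 n
  rw [coeff_map, coeff_ofA, coeff_ofA]; split_ifs <;> simp

theorem map_ofB (P : R⟦X⟧) : map f (ofB P) = ofB (PowerSeries.map f P) := by
  ext1 n
  rw [coeff_map, coeff_ofB, coeff_ofB]; simp

theorem map_a : map f a = a := by rw [a, map_ofA, PowerSeries.map_X, a]

theorem map_b : map f b = b := by rw [b, map_ofB, PowerSeries.map_X, b]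

theorem map_sub_smul_b (r : R) : map f (a - r • b) = a - f r • b := by
  rw [map_sub, map_a, smul_b, smul_b, map_ofB]; simp

end map

/-- A product of elements with initial forms `a - λ_j b` is a unit times
`∏ (a - λ_j b) S_j(b)⁻¹`, and the construction recovers the `S_j` after a change of coefficients that
puts the factors in this form. -/
theorem exists_prod_eq [Algebra ℚ R] (k : ℕ) (lam : Fin k → R) (x : Fin k → AHat R)
    (hx : ∀ j, HasInitialForm (lam j) (x j)) :
    ∃ (u : AHat R) (S T : Fin k → R⟦X⟧), PowerSeries.constantCoeff (coeff 0 u) = 1 ∧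
      (∀ j, PowerSeries.constantCoeff (S j) = 1) ∧ (∀ j, S j * T j = 1) ∧
      (List.ofFn x).prod = u * (List.ofFn fun j => (a - lam j • b) * ofB (T j)).prod ∧
      ∀ (f : R →+* ℂ) (S₀ : Fin k → ℂ⟦X⟧), (∀ j, PowerSeries.constantCoeff (S₀ j) = 1) →
        (∀ j, map f (x j) = (a - f (lam j) • b) * ofB (S₀ j)⁻¹) →
        map f u = 1 ∧ ∀ j, PowerSeries.map f (S j) = S₀ j := by
  induction k with
  | zero => exact ⟨1, Fin.elim0, Fin.elim0, by simp [coeff_one], fun j => j.elim0,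
      fun j => j.elim0, by simp, fun f S₀ _ _ => ⟨map_one _, fun j => j.elim0⟩⟩
  | succ k ih =>
    obtain ⟨u, S, T, hu, hS, hST, hprod, hsp⟩ :=
      ih (fun j => lam j.succ) (fun j => x j.succ) fun j => hx j.succ
    -- The first factor is multiplied by the unit `u` of the tail before being factored itself.
    obtain ⟨u', S', T', hu', hS', hST', h'⟩ := ((hx 0).mul hu).exists_eq_mul
    refine ⟨u', Fin.cons S' S, Fin.cons T' T, hu', Fin.cases hS' hS, Fin.cases hST' hST, ?_, ?_⟩
    · rw [List.ofFn_succ, List.prod_cons, hprod, ← mul_assoc, h', List.ofFn_succ, List.prod_cons]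
      simp only [Fin.cons_zero, Fin.cons_succ, mul_assoc]
    · intro f S₀ hS₀ hf
      obtain ⟨h1, h2⟩ := hsp f (fun j => S₀ j.succ) (fun j => hS₀ _) fun j => hf _
      -- Since `u` specializes to `1`, this identity compares two factorizations of the first
      -- factor; uniqueness gives `u' ↦ 1` and `T' ↦ (S₀ 0)⁻¹`.
      have h3 := congrArg (map f) h'
      rw [map_mul, h1, mul_one, hf 0, map_mul, map_mul, map_sub_smul_b, map_ofB] at h3
      have hc : PowerSeries.map f S' * PowerSeries.map f T' = 1 := by
        rw [← map_mul, hST', map_one]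
      have hcS : PowerSeries.constantCoeff (PowerSeries.map f S') = 1 := by
        rw [← PowerSeries.coeff_zero_eq_constantCoeff_apply, PowerSeries.coeff_map,
          PowerSeries.coeff_zero_eq_constantCoeff_apply, hS', map_one]
      have hcT : PowerSeries.constantCoeff (PowerSeries.map f T') = 1 := by
        have := congrArg PowerSeries.constantCoeff hc
        rwa [map_mul, hcS, one_mul, map_one] at this
      obtain ⟨h4, h5⟩ := eq_of_mul_eq (by simp [hS₀]) hcT h3.symm
      refine ⟨h4, Fin.cases ?_ h2⟩
      rw [Fin.cons_zero]
      rw [h5] at hc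
      have h0 : S₀ 0 * (S₀ 0)⁻¹ = 1 := PowerSeries.mul_inv_cancel _ (by simp [hS₀])
      calc _ = PowerSeries.map f S' * (S₀ 0 * (S₀ 0)⁻¹) := by rw [h0, mul_one]
        _ = S₀ 0 * (PowerSeries.map f S' * (S₀ 0)⁻¹) := by ring
        _ = S₀ 0 := by rw [hc, mul_one]

/-- Every element is a `b`-adic limit of polynomials in `b` with coefficients in `R⟦a⟧`, and `hf` is
continuity of `f` for this filtration. -/
theorem eq_self_of_fixed (f : AHat R →+* AHat R) (hA : ∀ P, f (ofA P) = ofA P) (hb : f b = b)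
    (hf : ∀ N x, (∀ n < N, coeff n x = 0) → ∀ n < N, coeff n (f x) = 0) (x : AHat R) :
    f x = x := by
  ext1 n
  have h := hf (n + 1) (x - ∑ ν ∈ Finset.range (n + 1), ofA (coeff ν x) * b ^ ν)
    (fun m hm => by rw [coeff_sub, ← coeff_sum_range x hm, sub_self]) n (by omega)
  rw [map_sub, map_sum] at h
  simp only [map_mul, map_pow, hA, hb] at h
  rwa [coeff_sub, ← coeff_sum_range x (by omega), sub_eq_zero] at h

end AHat

/-! ### Inverse, specialization and initial forms of changes of variable. -/

namespace ChangeOfVariable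

open AHat

variable {R : Type*} [CommRing R] (θ η : ChangeOfVariable R)

theorem hom_ofA (P : R⟦X⟧) : θ.hom (ofA P) = ofA (P.subst θ.series) := by
  rw [← phi_apply]; exact θ.toFun_ofA P

theorem coeff_hom_eq_zero (N : ℕ) (x : AHat R) (h : ∀ n < N, coeff n x = 0) :
    ∀ n < N, coeff n (θ.hom x) = 0 := fun n hn =>
  (θ.toFun_congr (y := 0) h n hn).trans (by rw [toFun_zero]; rfl)

variable {θ η} in
/-- `Θ_θ ∘ Θ_η = id` if `η ∘ θ = id`. -/
theorem hom_hom_of_subst_eq_X (h : η.series.subst θ.series = PowerSeries.X) (x : AHat R) :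
    θ.hom (η.hom x) = x := by
  refine eq_self_of_fixed (θ.hom.comp η.hom) (fun P => ?_) ?_ (fun N x hx => ?_) x
  · rw [RingHom.comp_apply, hom_ofA, hom_ofA,
      PowerSeries.subst_comp_subst_apply η.hasSubst θ.hasSubst, h, PowerSeries.X_subst]
  -- By the chain rule `(η' ∘ θ) θ' = 1`, so `b η'(a)` is sent to `b θ'(a) η'(θ(a)) = b`.
  · have hd := congrArg (PowerSeries.derivative R) h
    rw [PowerSeries.derivative_subst θ.hasSubst, PowerSeries.derivative_X] at hd
    rw [RingHom.comp_apply, hom_b, beta, map_mul, hom_b, hom_ofA, beta, mul_assoc, ← map_mul,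
      mul_comm (PowerSeries.derivative R _), hd, map_one, mul_one]
  · exact θ.coeff_hom_eq_zero N _ (η.coeff_hom_eq_zero N _ hx)

variable {θ} in
theorem hom_eq_self_of_series_eq_X (h : θ.series = PowerSeries.X) (x : AHat R) : θ.hom x = x := by
  refine eq_self_of_fixed θ.hom (fun P => ?_) ?_ θ.coeff_hom_eq_zero x
  · rw [hom_ofA, h, PowerSeries.X_subst]
  · rw [hom_b, beta, h, PowerSeries.derivative_X, map_one, mul_one]

/-- The inverse change of variable. -/
def symm : ChangeOfVariable R where
  series := PowerSeries.substInvOfIsUnit θ.series θ.isUnit_coeff_one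
  constantCoeff_eq_zero := PowerSeries.constantCoeff_substInvOfIsUnit _ _
  isUnit_coeff_one := by rw [PowerSeries.coeff_one_substInvOfIsUnit]; exact Units.isUnit _

theorem symm_subst : θ.symm.series.subst θ.series = PowerSeries.X :=
  PowerSeries.subst_substInvOfIsUnit_left _ θ.constantCoeff_eq_zero _

theorem subst_symm : θ.series.subst θ.symm.series = PowerSeries.X :=
  PowerSeries.subst_substInvOfIsUnit_right _ θ.constantCoeff_eq_zero _

theorem coeff_one_symm (h : PowerSeries.coeff 1 θ.series = 1) :
    PowerSeries.coeff 1 θ.symm.series = 1 := by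
  have h1 : ((θ.isUnit_coeff_one.unit : Rˣ) : R) = 1 := h
  have h2 : θ.isUnit_coeff_one.unit = 1 := Units.ext h1
  rw [symm, PowerSeries.coeff_one_substInvOfIsUnit, h2]; simp

/-- Change of coefficients. -/
def map {S : Type*} [CommRing S] (f : R →+* S) : ChangeOfVariable S where
  series := PowerSeries.map f θ.series
  constantCoeff_eq_zero := by
    rw [← PowerSeries.coeff_zero_eq_constantCoeff_apply, PowerSeries.coeff_map,
      PowerSeries.coeff_zero_eq_constantCoeff_apply, θ.constantCoeff_eq_zero, map_zero]
  isUnit_coeff_one := by rw [PowerSeries.coeff_map]; exact θ.isUnit_coeff_one.map f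

/-- Each coefficient of `Θ(x)` is a finite expression in substitutions, derivatives and products,
all compatible with `f`. This carries the generic identity to each particular `θ`. -/
theorem map_hom {S : Type*} [CommRing S] (f : R →+* S) (x : AHat R) :
    AHat.map f (θ.hom x) = (θ.map f).hom (AHat.map f x) := by
  have hphi : ∀ P, AHat.map f (θ.phi P) = (θ.map f).phi (PowerSeries.map f P) := fun P => by
    rw [phi_apply, phi_apply, map_ofA]
    exact congrArg ofA (PowerSeries.map_subst θ.hasSubst P)
  have hbeta : AHat.map f θ.beta = (θ.map f).beta := by
    rw [beta, beta, map_mul, map_b, map_ofA, PowerSeries.map_derivative]; rfl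
  have hcoeff : ∀ n, coeff n (θ.hom x) = coeff n (∑ ν ∈ Finset.range (n + 1),
      θ.phi (coeff ν x) * θ.beta ^ ν) := fun n => rfl
  ext1 n
  have hcoeff' : coeff n ((θ.map f).hom (AHat.map f x)) = coeff n (∑ ν ∈ Finset.range (n + 1),
      (θ.map f).phi (coeff ν (AHat.map f x)) * (θ.map f).beta ^ ν) := rfl
  rw [coeff_map, hcoeff, hcoeff', ← coeff_map, map_sum]
  simp only [map_mul, map_pow, hphi, hbeta, coeff_map]

/-- For unimodular `θ`, `α = a` and `β = b` up to terms of total degree at least 2, and `T(β)` has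
constant term `1`. -/
theorem hasInitialForm_hom (h : PowerSeries.coeff 1 θ.series = 1) (r : R) {T : R⟦X⟧}
    (hT : PowerSeries.constantCoeff T = 1) :
    HasInitialForm r (θ.hom ((a - r • b) * ofB T)) := by
  have hsm : θ.hom (r • b) = r • θ.beta := by
    rw [Algebra.smul_def, map_mul, hom_b, Algebra.smul_def]
    congr 1
    have : algebraMap R (AHat R) r = ofA (PowerSeries.C r) := by
      ext1 n
      rw [Algebra.algebraMap_eq_smul_one, coeff_smul, coeff_one, coeff_ofA]
      split_ifs <;> simp [PowerSeries.smul_eq_C_mul]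
    rw [this, hom_ofA, PowerSeries.subst_C]; rfl
  rw [map_mul, map_sub, hom_a, hsm]
  refine HasInitialForm.mul ⟨?_, ?_, ?_⟩ ?_
  · simp [alpha, beta, b_mul, coeff_ofA, θ.constantCoeff_eq_zero]
  · simp [alpha, beta, b_mul, coeff_ofA, h]
  · rw [beta, b_mul, alpha, coeff_sub, coeff_smul, coeff_bMul_succ]
    have h1 : PowerSeries.constantCoeff (PowerSeries.derivative R θ.series) = 1 := by
      rw [← PowerSeries.coeff_zero_eq_constantCoeff_apply, PowerSeries.coeff_derivative, h]; simp
    simp [coeff_ofA, h1]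
  · have h0 : coeff 0 (θ.hom (ofB T)) = 1 := by
      have : coeff 0 (θ.hom (ofB T)) = coeff 0 (∑ ν ∈ Finset.range 1,
        θ.phi (coeff ν (ofB T)) * θ.beta ^ ν) := rfl
      rw [this, Finset.sum_range_one, coeff_ofB, pow_zero, mul_one,
        PowerSeries.coeff_zero_eq_constantCoeff_apply, hT, map_one, map_one, coeff_one, if_pos rfl]
    rw [h0, map_one]

end ChangeOfVariable

/-! ### The generic change of variable and its specializations. -/

section Generic

open AHat

/-- The change of variable `a + ∑ θ_i a^i` with indeterminate coefficients. -/
def genericChange (k : ℕ) : ChangeOfVariable (MvPolynomial (CoeffVar k) ℂ) where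
  series := PowerSeries.mk fun n =>
    if h : 2 ≤ n then MvPolynomial.X (.inl ⟨n, h⟩) else if n = 1 then 1 else 0
  constantCoeff_eq_zero := by
    rw [← PowerSeries.coeff_zero_eq_constantCoeff_apply, PowerSeries.coeff_mk]; simp
  isUnit_coeff_one := by rw [PowerSeries.coeff_mk]; simp

/-- The series `1 + ∑ s_{j,i} b^i` with indeterminate coefficients. -/
def genericSeries (k : ℕ) (j : Fin k) : PowerSeries (MvPolynomial (CoeffVar k) ℂ) :=
  PowerSeries.mk fun n => if h : 1 ≤ n then MvPolynomial.X (.inr (j, ⟨n, h⟩)) else 1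

variable {k : ℕ}

theorem coeff_one_genericChange : PowerSeries.coeff 1 (genericChange k).series = 1 := by
  rw [genericChange, PowerSeries.coeff_mk]; simp

theorem constantCoeff_genericSeries (j : Fin k) :
    PowerSeries.constantCoeff (genericSeries k j) = 1 := by
  rw [← PowerSeries.coeff_zero_eq_constantCoeff_apply, genericSeries, PowerSeries.coeff_mk]; simp

theorem specialize_genericChange {θ : ℂ⟦X⟧} (S : Fin k → ℂ⟦X⟧)
    (h0 : PowerSeries.constantCoeff θ = 0) (h1 : PowerSeries.coeff 1 θ = 1) :
    specialize θ S (genericChange k).series = θ := by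
  ext n
  rw [specialize, PowerSeries.coeff_map, genericChange, PowerSeries.coeff_mk]
  rcases n with _ | _ | n
  · simp [h0]
  · simp [h1]
  · simp [CoeffVar.value]

theorem specialize_genericSeries (θ : ℂ⟦X⟧) {S : Fin k → ℂ⟦X⟧}
    (h : ∀ j, PowerSeries.constantCoeff (S j) = 1) (j : Fin k) :
    specialize θ S (genericSeries k j) = S j := by
  ext n
  rw [specialize, PowerSeries.coeff_map, genericSeries, PowerSeries.coeff_mk]
  rcases n with _ | n
  · simp [h]
  · simp [CoeffVar.value]

theorem PowerSeries.eq_inv_of_mul_eq_one {K : Type*} [Field K] {S T : K⟦X⟧} (h : S * T = 1) : T = S⁻¹ := by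
  have hS : PowerSeries.constantCoeff S ≠ 0 := fun h0 => by
    have := congrArg PowerSeries.constantCoeff h
    simp [h0] at this
  calc T = (S⁻¹ * S) * T := by rw [PowerSeries.inv_mul_cancel _ hS, one_mul]
    _ = S⁻¹ := by rw [mul_assoc, h, mul_one]

/-- The factors of the inverse image of the generic `P⁰` under the generic change of variable. -/
def genericFactor (lam : Fin k → ℂ) (j : Fin k) : AHat (MvPolynomial (CoeffVar k) ℂ) :=
  (genericChange k).symm.hom ((a - (MvPolynomial.C (lam j) : MvPolynomial (CoeffVar k) ℂ) • b) *
    ofB (PowerSeries.invOfUnit (genericSeries k j) 1))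

theorem hasInitialForm_genericFactor (lam : Fin k → ℂ) (j : Fin k) :
    HasInitialForm (MvPolynomial.C (lam j)) (genericFactor lam j) :=
  ChangeOfVariable.hasInitialForm_hom _
    (ChangeOfVariable.coeff_one_symm _ coeff_one_genericChange) _ (by simp)

theorem map_genericFactor (lam : Fin k → ℂ) (θ : ℂ⟦X⟧) {S : Fin k → ℂ⟦X⟧}
    (h : ∀ j, PowerSeries.constantCoeff (S j) = 1) (j : Fin k) :
    AHat.map (MvPolynomial.eval (CoeffVar.value θ S)) (genericFactor lam j) =
      ((genericChange k).symm.map (MvPolynomial.eval (CoeffVar.value θ S))).hom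
        ((a - lam j • b) * ofB (S j)⁻¹) := by
  rw [genericFactor, ChangeOfVariable.map_hom, map_mul, map_sub_smul_b, map_ofB,
    MvPolynomial.eval_C]
  congr 3
  refine PowerSeries.eq_inv_of_mul_eq_one ?_
  conv_lhs => rw [← specialize_genericSeries θ h j]
  rw [specialize, ← map_mul, PowerSeries.mul_invOfUnit _ _ (constantCoeff_genericSeries j), map_one]

variable {θ : ChangeOfVariable ℂ} (S : Fin k → ℂ⟦X⟧)

/-- The inverse of `θ` is taken to be the specialization of the generic inverse. This and
`subst_map_symm` specialize the two generic inversion identities, so specialization and inversion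
need no separate comparison. -/
theorem map_symm_subst (hθ : PowerSeries.coeff 1 θ.series = 1) :
    ((genericChange k).symm.map (MvPolynomial.eval (CoeffVar.value θ.series S))).series.subst
      θ.series = PowerSeries.X := by
  have h := congrArg (PowerSeries.map (MvPolynomial.eval (CoeffVar.value θ.series S)))
    (genericChange k).symm_subst
  have e : PowerSeries.map (MvPolynomial.eval (CoeffVar.value θ.series S))
      (genericChange k).series = θ.series :=
    specialize_genericChange S θ.constantCoeff_eq_zero hθ
  have h2 := PowerSeries.map_subst (genericChange k).hasSubst
    (h := MvPolynomial.eval (CoeffVar.value θ.series S)) (genericChange k).symm.series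
  rw [PowerSeries.map_X] at h
  exact (h2.trans (congrArg (PowerSeries.subst · _) e)).symm.trans h

theorem subst_map_symm (hθ : PowerSeries.coeff 1 θ.series = 1) :
    θ.series.subst ((genericChange k).symm.map
      (MvPolynomial.eval (CoeffVar.value θ.series S))).series = PowerSeries.X := by
  have h := congrArg (PowerSeries.map (MvPolynomial.eval (CoeffVar.value θ.series S)))
    (genericChange k).subst_symm
  have e : PowerSeries.map (MvPolynomial.eval (CoeffVar.value θ.series S))
      (genericChange k).series = θ.series :=
    specialize_genericChange S θ.constantCoeff_eq_zero hθ
  have h2 := PowerSeries.map_subst (genericChange k).symm.hasSubst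
    (h := MvPolynomial.eval (CoeffVar.value θ.series S)) (genericChange k).series
  rw [PowerSeries.map_X] at h
  exact (congrArg (PowerSeries.subst _ ·) e).symm.trans (h2.symm.trans h)

end Generic

end

/-! ### The theorem. -/

theorem mainTheorem9 (k : ℕ) (lam : Fin k → ℂ) :
    ∃ S : Fin k → PowerSeries (MvPolynomial (CoeffVar k) ℂ),
      (∀ j, PowerSeries.constantCoeff (S j) = 1) ∧
      (∀ S₀ : Fin k → PowerSeries ℂ, (∀ j, PowerSeries.constantCoeff (S₀ j) = 1) →
        ∀ j, specialize PowerSeries.X S₀ (S j) = S₀ j) ∧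
      (∃ m : ℕ → ℕ, ∀ (q : ℕ) (j : Fin k), ∀ v ∈ (PowerSeries.coeff q (S j)).vars,
        CoeffVar.index v < m q) ∧
      ∀ (E : Type u) [AddCommGroup E] [Module (AHat ℂ) E], IsFresco k E →
        ∀ e : E, IsGenerator e →
        ∀ S₀ : Fin k → PowerSeries ℂ, (∀ j, PowerSeries.constantCoeff (S₀ j) = 1) →
        AnnihilatorGeneratedBy e (frescoElement lam S₀) →
        ∀ θ : ChangeOfVariable ℂ, PowerSeries.coeff 1 θ.series = 1 →
          IsGenerator (Pushforward.of θ E e) ∧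
          AnnihilatorGeneratedBy (Pushforward.of θ E e)
            (frescoElement lam fun j => specialize θ.series S₀ (S j)) := by

  obtain ⟨U, S, T, hU, hS, hST, hprod, hsp⟩ := AHat.exists_prod_eq k
    (fun j => MvPolynomial.C (lam j)) (genericFactor lam) (hasInitialForm_genericFactor lam)
  -- `m(q)` is one more than the largest index of a variable in the coefficients of `b^q` of the
  -- finitely many `S_j`.
  refine ⟨S, hS, fun S₀ hS₀ => ?_, ⟨fun q => (Finset.univ.sup fun j : Fin k =>
    (PowerSeries.coeff q (S j)).vars.sup CoeffVar.index) + 1, fun q j v hv => ?_⟩, ?_⟩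
  -- At `θ = id` the specialized inverse is the identity too, so the generic factors specialize to
  -- the factors of `P⁰` and the last clause of `exists_prod_eq` applies.
  · let θ : ChangeOfVariable ℂ := ⟨PowerSeries.X, by simp, by simp⟩
    have hX := map_symm_subst (θ := θ) S₀ (by simp [θ])
    rw [show θ.series = PowerSeries.X from rfl, PowerSeries.X_subst] at hX
    refine (hsp (MvPolynomial.eval (CoeffVar.value PowerSeries.X S₀)) S₀ hS₀ fun j => ?_).2
    rw [map_genericFactor lam _ hS₀, ChangeOfVariable.hom_eq_self_of_series_eq_X hX,
      MvPolynomial.eval_C]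
  · rw [Nat.lt_succ_iff]
    exact (Finset.le_sup (f := CoeffVar.index) hv).trans (Finset.le_sup
      (f := fun j : Fin k => (PowerSeries.coeff q (S j)).vars.sup CoeffVar.index)
      (Finset.mem_univ j))
  · intro E _ _ _ e he S₀ hS₀ hann θ hθ
    set ev := MvPolynomial.eval (CoeffVar.value θ.series S₀) with hev
    set η := (genericChange k).symm.map ev
    have hθη : ∀ x, θ.hom (η.hom x) = x :=
      ChangeOfVariable.hom_hom_of_subst_eq_X (map_symm_subst S₀ hθ)
    have hηθ : ∀ x, η.hom (θ.hom x) = x :=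
      ChangeOfVariable.hom_hom_of_subst_eq_X (subst_map_symm S₀ hθ)
    -- The generic factorization, specialized: `Θ⁻¹(P⁰)` is a unit times `P(θ, s⁰)`.
    have hP : η.hom (frescoElement lam S₀) =
        AHat.map ev U * frescoElement lam fun j => specialize θ.series S₀ (S j) := by
      have h := congrArg (AHat.map ev) hprod
      rw [map_mul, map_list_prod, map_list_prod, List.map_ofFn, List.map_ofFn] at h
      rw [frescoElement, frescoElement, map_list_prod, List.map_ofFn]
      have h1 : ⇑(AHat.map ev) ∘ genericFactor lam = ⇑η.hom ∘ fun j =>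
          (AHat.a - lam j • AHat.b) * AHat.ofB (S₀ j)⁻¹ :=
        funext fun j => map_genericFactor lam θ.series hS₀ j
      have h2 : (⇑(AHat.map ev) ∘ fun j => (AHat.a - (MvPolynomial.C (lam j) :
          MvPolynomial (CoeffVar k) ℂ) • AHat.b) * AHat.ofB (T j)) = fun j =>
          (AHat.a - lam j • AHat.b) * AHat.ofB (specialize θ.series S₀ (S j))⁻¹ := funext fun j => by
        have hc : specialize θ.series S₀ (S j) * PowerSeries.map ev (T j) = 1 := by
          rw [specialize, ← map_mul, hST, map_one]
        rw [Function.comp_apply, map_mul, AHat.map_sub_smul_b, AHat.map_ofB, hev,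
          MvPolynomial.eval_C, ← PowerSeries.eq_inv_of_mul_eq_one hc]
      rwa [h1, h2] at h
    -- A left inverse of the unit suffices for `Θ⁻¹(P⁰)` and `P(θ, s⁰)` to generate the same left
    -- ideal.
    obtain ⟨V, hV⟩ := AHat.exists_mul_eq_one (u := AHat.map ev U) (by
      rw [AHat.coeff_map, ← PowerSeries.coeff_zero_eq_constantCoeff_apply, PowerSeries.coeff_map,
        PowerSeries.coeff_zero_eq_constantCoeff_apply, hU, map_one])
    constructor
    · rw [IsGenerator, eq_top_iff]
      intro x _
      obtain ⟨u, hu⟩ := Submodule.mem_span_singleton.mp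
        (he ▸ Submodule.mem_top : (Pushforward.of θ E).symm x ∈ Submodule.span (AHat ℂ) {e})
      -- `Θ⁻¹(u)` acts on `θ_*(E)` as `u` acts on `E`.
      refine Submodule.mem_span_singleton.mpr ⟨η.hom u, ?_⟩
      rw [Pushforward.smul_of, hθη, hu, AddEquiv.apply_symm_apply]
    · intro u
      rw [Pushforward.smul_of, map_eq_zero_iff _ (Pushforward.of θ E).injective, hann]
      constructor
      · rintro ⟨w, hw⟩
        exact ⟨η.hom w * AHat.map ev U, by rw [← hηθ u, hw, map_mul, hP, mul_assoc]⟩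
      · rintro ⟨v, rfl⟩
        refine ⟨θ.hom (v * V), ?_⟩
        rw [← hθη (frescoElement lam S₀), hP, ← map_mul, mul_assoc v, ← mul_assoc V, hV, one_mul]
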